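/- Let $I\subset\mathbb R$ be an open interval and $\alpha:I\to\mathbb R^3$ a smooth curve parametrized by arc length, with curvature $\kappa=\|\alpha''\|$ and smooth Frenet frame $\{T,N,B\}$, that is: $T=\alpha'$, $N$ is a smooth unit vector field along $\alpha$ orthogonal to $T$ with $T'=\kappa N$, and $B=T\times N$; let $\tau=\langle N',B\rangle$ be the torsion. (If $\kappa>0$ on $I$, this is the usual Frenet frame and it exists.) Let $\theta:I\to\mathbb R$ be smooth, and consider the osculating-type (OT) ruled surface $$\varphi(s,u)=\alpha(s)+u\,(\cos\theta(s)\,T(s)+\sin\theta(s)\,N(s)),\qquad (s,u)\in I\times\mathbb R .$$ Put $\eta=\theta'+\kappa$, $\mu=\tau\sin\theta$, $\xi=\tau\cos\theta$, $f=\sin\theta-u\eta$, $g=u\mu$. Assume that there is no nonempty open subinterval of $I$ on which $\sin\theta$ and $\kappa$ both vanish identically (this holds if $\kappa>0$). If $\alpha$ is not a plane curve (its image lies in no plane), then $\varphi(I\times\mathbb R)$ is a helicoid if and only if $$(f^2+g^2)\,\xi+\mu\sin\theta\cos\theta+g^2\Big(\frac fg\Big)_s=0\qquad\text{for all }(s,u)\in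 I\times\mathbb R,$$ where $g^2(f/g)_s$ stands for $g f_s-f g_s$, also where $g=0$. Here "a helicoid" means a set that some isometry of $\mathbb R^3$ carries to $\{(v\cos t,\,v\sin t,\,ct): t\in J,\ v\in\mathbb R\}$ for some $c\neq0$ and some nonempty open interval $J\subset\mathbb R$ (the whole helicoid if $J=\mathbb R$). -/

import Mathlib

open scoped ContDiff

noncomputable section

/-- Euclidean 3-space. -/
abbrev E3 := EuclideanSpace ℝ (Fin 3)

/-- The vector product of Euclidean 3-space. -/
def vecProd (v w : E3) : E3 := WithLp.toLp 2 (crossProduct v.ofLp w.ofLp)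

/-- The curvature of a curve parametrized by arc length. -/
def curvature (α : ℝ → E3) (s : ℝ) : ℝ := ‖deriv (deriv α) s‖

/-- `α` is a smooth curve on the open interval `I`, parametrized by arc length, and `N` is a smooth
principal normal field of it, so that `α', N, α' × N` is a smooth Frenet frame. Where the curvature
is nonzero, `N = α'' / ‖α''‖` is determined by `α`; in particular, if the curvature vanishes
nowhere, then there is exactly one such `N`. -/
structure IsFrenetCurve (I : Set ℝ) (α N : ℝ → E3) : Prop where
  isOpen : IsOpen I
  ordConnected : I.OrdConnected
  smooth : ContDiffOn ℝ ∞ α I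
  unit_speed : ∀ s ∈ I, ‖deriv α s‖ = 1
  smooth_normal : ContDiffOn ℝ ∞ N I
  norm_normal : ∀ s ∈ I, ‖N s‖ = 1
  inner_normal : ∀ s ∈ I, inner ℝ (deriv α s) (N s) = 0
  deriv_tangent : ∀ s ∈ I, deriv (deriv α) s = curvature α s • N s

/-- The binormal `B = T × N`. -/
def binormal (α N : ℝ → E3) (s : ℝ) : E3 := vecProd (deriv α s) (N s)

/-- The torsion `τ = ⟨N', B⟩`. -/
def torsion (α N : ℝ → E3) (s : ℝ) : ℝ := inner ℝ (deriv N s) (binormal α N s)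

namespace OTSurface

/-- The ruling direction `q = cos θ T + sin θ N`. -/
def ruling (α N : ℝ → E3) (θ : ℝ → ℝ) (s : ℝ) : E3 :=
  Real.cos (θ s) • deriv α s + Real.sin (θ s) • N s

/-- The osculating-type ruled surface `φ(s, u) = α(s) + u q(s)`. -/
def param (α N : ℝ → E3) (θ : ℝ → ℝ) (s u : ℝ) : E3 := α s + u • ruling α N θ s

/-- The set of points `φ(s, u)` with `s ∈ I` and `u ∈ ℝ`. -/
def points (I : Set ℝ) (α N : ℝ → E3) (θ : ℝ → ℝ) : Set E3 :=
  {p | ∃ s ∈ I, ∃ u : ℝ, p = param α N θ s u}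

def eta (α : ℝ → E3) (θ : ℝ → ℝ) (s : ℝ) : ℝ := deriv θ s + curvature α s

def mu (α N : ℝ → E3) (θ : ℝ → ℝ) (s : ℝ) : ℝ := torsion α N s * Real.sin (θ s)

def xi (α N : ℝ → E3) (θ : ℝ → ℝ) (s : ℝ) : ℝ := torsion α N s * Real.cos (θ s)

def f (α : ℝ → E3) (θ : ℝ → ℝ) (s u : ℝ) : ℝ := Real.sin (θ s) - u * eta α θ s

def g (α N : ℝ → E3) (θ : ℝ → ℝ) (s u : ℝ) : ℝ := u * mu α N θ s

/-- The term `g² (f / g)_s`, written as `g f_s - f g_s` so that it also makes sense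
(and is continuous) at the points where `g = 0`. -/
def quotTerm (α N : ℝ → E3) (θ : ℝ → ℝ) (s u : ℝ) : ℝ :=
  g α N θ s u * deriv (fun t => f α θ t u) s - f α θ s u * deriv (fun t => g α N θ t u) s

/-- Where `g ≠ 0`, `quotTerm` is literally `g² (f / g)_s`. -/
theorem quotTerm_eq (α N : ℝ → E3) (θ : ℝ → ℝ) (s u : ℝ)
    (hf : DifferentiableAt ℝ (fun t => f α θ t u) s)
    (hg : DifferentiableAt ℝ (fun t => g α N θ t u) s) (h0 : g α N θ s u ≠ 0) :
    quotTerm α N θ s u = g α N θ s u ^ 2 * deriv (fun t => f α θ t u / g α N θ t u) s := by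
  rw [deriv_fun_div hf hg h0, quotTerm]
  field_simp

end OTSurface

/-- The part of the helicoid with axis the third coordinate axis and parameter `c` that is swept out
by the (complete) rulings with parameter in `J`; for `J = ℝ` it is the whole helicoid. -/
def helicoidOver (c : ℝ) (J : Set ℝ) : Set E3 :=
  {p | ∃ t ∈ J, ∃ v : ℝ, p = !₂[v * Real.cos t, v * Real.sin t, c * t]}

/-- Up to a rigid motion, `S` is a helicoid, or the part of a helicoid swept out by its rulings over
an open interval. -/
def IsHelicoid (S : Set E3) : Prop :=
  ∃ c : ℝ, c ≠ 0 ∧ ∃ J : Set ℝ, IsOpen J ∧ J.OrdConnected ∧ J.Nonempty ∧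
    ∃ Φ : E3 ≃ᵃⁱ[ℝ] E3, S = Φ '' helicoidOver c J

end

/-!
The displayed equation is the vanishing of the mean curvature of `φ` (multiplied by a power of
`‖φ_s × φ_u‖`), so the theorem is a form of Catalan's theorem that the ruled minimal surfaces are
the planes and the helicoids. The computations take place in the orthonormal frame `q, w, B` of
ruling direction, `w = -sin θ T + cos θ N` and binormal, in which `q' = η w + μ B`,
`w' = -η q + ξ B`, `B' = -μ q - ξ w` and `φ_s = cos θ q - f w + g B`.

*A helicoid satisfies the equation* (`equation_of_isHelicoid`). In coordinates adapted to it, the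
helicoid lies in `x sin (z / c) = y cos (z / c)`. A line inside it is the axis or a horizontal
ruling (`line_subset_helicoid`). By connectedness one alternative holds for all `s ∈ I`, and if
every ruling of the surface were the axis, the base curve would be straight. So all of them are
horizontal: `q' = δ P` and `P' = -δ q` for a horizontal unit field `P` orthogonal to `q`, where `δ`
is the rate of turning, and `φ_s = cos θ q + δ Y` with `Y = (m + u) P + c e₂` and `m' = cos θ`.
Hence `f = -δ ⟨Y, w⟩` and `g = δ ⟨Y, B⟩`; differentiating these products in `s` gives the equation
identically, with no division by `δ` and also at singular points (`equation_of_frame`).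

*The equation gives a helicoid* (`isHelicoid_of_equation`). The equation is polynomial in `u`. Its
coefficients show that where `τ cos θ ≠ 0` both `sin θ` and `κ` vanish, which is excluded; so
`τ cos θ = 0` throughout, and then `τ ^ 2` is constant. If it is zero, the binormal is constant and
the curve is planar (`FrenetEquations.coplanar`). Otherwise `cos θ = 0` and `κ`, `τ` are constant:
the base curve is a circular helix (a straight line if `κ = 0`) and the rulings are its principal
normals, which sweep out a helicoid about the axis of the helix (`isHelicoid_of_constant`).
-/

/-! ### The vector product -/

theorem inner_eq_sum_three (v w : E3) : inner ℝ v w = v 0 * w 0 + v 1 * w 1 + v 2 * w 2 := by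
  simp [PiLp.inner_apply, Fin.sum_univ_three, mul_comm]

theorem vecProd_eq (v w : E3) :
    vecProd v w = !₂[v 1 * w 2 - v 2 * w 1, v 2 * w 0 - v 0 * w 2, v 0 * w 1 - v 1 * w 0] := by
  simp [vecProd, cross_apply]

theorem inner_self_vecProd (v w : E3) : inner ℝ v (vecProd v w) = 0 := by
  simp [inner_eq_sum_three, vecProd_eq]; ring

theorem inner_right_vecProd (v w : E3) : inner ℝ w (vecProd v w) = 0 := by
  simp [inner_eq_sum_three, vecProd_eq]; ring

theorem inner_vecProd_self (v w : E3) : inner ℝ (vecProd v w) (vecProd v w) =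
    inner ℝ v v * inner ℝ w w - inner ℝ v w ^ 2 := by
  simp only [inner_eq_sum_three, vecProd_eq]
  simp; ring

theorem ContDiffOn.vecProd {n : WithTop ℕ∞} {I : Set ℝ} {v w : ℝ → E3} (hv : ContDiffOn ℝ n v I)
    (hw : ContDiffOn ℝ n w I) : ContDiffOn ℝ n (fun s => vecProd (v s) (w s)) I := by
  have hv' := (contDiffOn_euclidean (𝕜 := ℝ)).1 hv
  have hw' := (contDiffOn_euclidean (𝕜 := ℝ)).1 hw
  rw [contDiffOn_euclidean]
  intro i
  simp only [vecProd_eq]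
  fin_cases i
  · exact ((hv' 1).mul (hw' 2)).sub ((hv' 2).mul (hw' 1))
  · exact ((hv' 2).mul (hw' 0)).sub ((hv' 0).mul (hw' 2))
  · exact ((hv' 0).mul (hw' 1)).sub ((hv' 1).mul (hw' 0))

/-! ### Orthonormal bases and helicoids -/

/-- An orthonormal triple of vectors of Euclidean 3-space is an orthonormal basis. -/
theorem exists_orthonormalBasis_eq {a b c : E3} (haa : inner ℝ a a = (1 : ℝ))
    (hbb : inner ℝ b b = (1 : ℝ)) (hcc : inner ℝ c c = (1 : ℝ)) (hab : inner ℝ a b = (0 : ℝ))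
    (hac : inner ℝ a c = (0 : ℝ)) (hbc : inner ℝ b c = (0 : ℝ)) :
    ∃ e : OrthonormalBasis (Fin 3) ℝ E3, e 0 = a ∧ e 1 = b ∧ e 2 = c := by
  have hon : Orthonormal ℝ ![a, b, c] := by
    rw [orthonormal_iff_ite]
    intro i j
    fin_cases i <;> fin_cases j <;>
      simp [haa, hbb, hcc, hab, hac, hbc, real_inner_comm a, real_inner_comm b c,
        -inner_self_eq_norm_sq_to_K]
  let e := OrthonormalBasis.mk (v := ![a, b, c]) hon
    (by rw [hon.linearIndependent.span_eq_top_of_card_eq_finrank' (by simp)])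
  exact ⟨e, by simp [e], by simp [e], by simp [e]⟩

theorem OrthonormalBasis.eq_sum_three (e : OrthonormalBasis (Fin 3) ℝ E3) (v : E3) :
    v = inner ℝ (e 0) v • e 0 + inner ℝ (e 1) v • e 1 + inner ℝ (e 2) v • e 2 := by
  conv_lhs => rw [← e.sum_repr' v, Fin.sum_univ_three]

/-- Being a helicoid, in terms of an orthonormal basis adapted to it: the axis is the line through
`o` in the direction of `e 2`. -/
theorem isHelicoid_iff (S : Set E3) : IsHelicoid S ↔
    ∃ c : ℝ, c ≠ 0 ∧ ∃ J : Set ℝ, IsOpen J ∧ J.OrdConnected ∧ J.Nonempty ∧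
      ∃ (e : OrthonormalBasis (Fin 3) ℝ E3) (o : E3),
        S = {p | ∃ t ∈ J, ∃ v : ℝ,
          p = o + (v * Real.cos t) • e 0 + (v * Real.sin t) • e 1 + (c * t) • e 2} := by
  have key : ∀ (e : OrthonormalBasis (Fin 3) ℝ E3) (x y z : ℝ),
      e.repr.symm !₂[x, y, z] = x • e 0 + y • e 1 + z • e 2 := by
    intro e x y z
    rw [← e.sum_repr_symm, Fin.sum_univ_three]
    simp
  unfold IsHelicoid
  refine exists_congr fun c => and_congr_right fun _ => exists_congr fun J =>
    and_congr_right fun _ => and_congr_right fun _ => and_congr_right fun _ => ?_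
  constructor
  · rintro ⟨Φ, rfl⟩
    let e := (EuclideanSpace.basisFun (Fin 3) ℝ).map Φ.linearIsometryEquiv
    have he : e.repr.symm = Φ.linearIsometryEquiv := by
      ext1 x
      rw [LinearIsometryEquiv.symm_apply_eq]
      ext i
      simp [e, OrthonormalBasis.map]
    have hΦ : ∀ x y z : ℝ, Φ !₂[x, y, z] = Φ 0 + x • e 0 + y • e 1 + z • e 2 := by
      intro x y z
      have := Φ.map_vadd 0 !₂[x, y, z]
      rw [← he, key] at this
      simp only [vadd_eq_add, add_zero] at this
      rw [this]; abel
    refine ⟨e, Φ 0, ?_⟩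
    ext p
    constructor
    · rintro ⟨_, ⟨t, ht, v, rfl⟩, rfl⟩
      exact ⟨t, ht, v, hΦ _ _ _⟩
    · rintro ⟨t, ht, v, rfl⟩
      exact ⟨_, ⟨t, ht, v, rfl⟩, hΦ _ _ _⟩
  · rintro ⟨e, o, rfl⟩
    let Φ : E3 ≃ᵃⁱ[ℝ] E3 :=
      e.repr.symm.toAffineIsometryEquiv.trans (AffineIsometryEquiv.constVAdd ℝ E3 o)
    have hΦ : ∀ x y z : ℝ, Φ !₂[x, y, z] = o + x • e 0 + y • e 1 + z • e 2 := by
      intro x y z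
      simp only [Φ, AffineIsometryEquiv.coe_trans, Function.comp_apply,
        LinearIsometryEquiv.coe_toAffineIsometryEquiv, key, AffineIsometryEquiv.coe_constVAdd,
        vadd_eq_add]
      abel
    refine ⟨Φ, ?_⟩
    ext p
    constructor
    · rintro ⟨t, ht, v, rfl⟩
      exact ⟨_, ⟨t, ht, v, rfl⟩, hΦ _ _ _⟩
    · rintro ⟨_, ⟨t, ht, v, rfl⟩, rfl⟩
      exact ⟨t, ht, v, hΦ _ _ _⟩

/-! ### Derivatives on open intervals -/

/-- A function with vanishing derivative on an open interval is constant there. -/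
theorem eq_of_hasDerivAt_zero {E : Type*} [NormedAddCommGroup E] [NormedSpace ℝ E] {I : Set ℝ}
    (ho : IsOpen I) (hc : I.OrdConnected) {F : ℝ → E} (hF : ∀ s ∈ I, HasDerivAt F 0 s)
    {s t : ℝ} (hs : s ∈ I) (ht : t ∈ I) : F s = F t :=
  ho.is_const_of_deriv_eq_zero hc.isPreconnected
    (fun x hx => (hF x hx).differentiableAt.differentiableWithinAt) (fun x hx => (hF x hx).deriv)
    hs ht

/-- Functions that agree on an open set have the same derivative there. -/
theorem HasDerivAt.eq_of_eqOn {E : Type*} [NormedAddCommGroup E] [NormedSpace ℝ E] {I : Set ℝ}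
    (ho : IsOpen I) {F G : ℝ → E} (h : ∀ s ∈ I, F s = G s) {s : ℝ} (hs : s ∈ I) {F' G' : E}
    (hF : HasDerivAt F F' s) (hG : HasDerivAt G G' s) : F' = G' :=
  (hF.congr_of_eventuallyEq (Filter.eventually_of_mem (ho.mem_nhds hs)
    fun t ht => (h t ht).symm)).unique hG

/-! ### Frenet equations -/

/-- The Frenet equations of `α' = T, N, B` on `I`, for an orthonormal frame `T, N, B` and
differentiable curvature `κ` and torsion `τ`. -/
structure FrenetEquations (I : Set ℝ) (α T N B : ℝ → E3) (κ τ : ℝ → ℝ) : Prop where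
  isOpen : IsOpen I
  ordConnected : I.OrdConnected
  hasDerivAt_curve : ∀ s ∈ I, HasDerivAt α (T s) s
  hasDerivAt_tangent : ∀ s ∈ I, HasDerivAt T (κ s • N s) s
  hasDerivAt_normal : ∀ s ∈ I, HasDerivAt N (-κ s • T s + τ s • B s) s
  hasDerivAt_binormal : ∀ s ∈ I, HasDerivAt B (-τ s • N s) s
  tangent_tangent : ∀ s ∈ I, inner ℝ (T s) (T s) = (1 : ℝ)
  normal_normal : ∀ s ∈ I, inner ℝ (N s) (N s) = (1 : ℝ)
  binormal_binormal : ∀ s ∈ I, inner ℝ (B s) (B s) = (1 : ℝ)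
  tangent_normal : ∀ s ∈ I, inner ℝ (T s) (N s) = (0 : ℝ)
  tangent_binormal : ∀ s ∈ I, inner ℝ (T s) (B s) = (0 : ℝ)
  normal_binormal : ∀ s ∈ I, inner ℝ (N s) (B s) = (0 : ℝ)
  differentiableAt_curvature : ∀ s ∈ I, DifferentiableAt ℝ κ s
  differentiableAt_torsion : ∀ s ∈ I, DifferentiableAt ℝ τ s

theorem IsFrenetCurve.frenetEquations {I : Set ℝ} {α N : ℝ → E3} (h : IsFrenetCurve I α N) :
    FrenetEquations I α (deriv α) N (binormal α N) (curvature α) (torsion α N) := by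
  have ho := h.isOpen
  have hT : ContDiffOn ℝ ∞ (deriv α) I := h.smooth.deriv_of_isOpen ho (by simp)
  have hT' : ContDiffOn ℝ ∞ (deriv (deriv α)) I := hT.deriv_of_isOpen ho (by simp)
  have hN' : ContDiffOn ℝ ∞ (deriv N) I := h.smooth_normal.deriv_of_isOpen ho (by simp)
  have hB : ContDiffOn ℝ ∞ (binormal α N) I := hT.vecProd h.smooth_normal
  have diffAt : ∀ {E : Type} [NormedAddCommGroup E] [NormedSpace ℝ E] {F : ℝ → E},
      ContDiffOn ℝ ∞ F I → ∀ s ∈ I, DifferentiableAt ℝ F s := fun hF s hs =>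
    (hF.contDiffAt (ho.mem_nhds hs)).differentiableAt (by simp)
  have hTT : ∀ s ∈ I, inner ℝ (deriv α s) (deriv α s) = (1 : ℝ) := fun s hs => by
    rw [real_inner_self_eq_norm_sq, h.unit_speed s hs, one_pow]
  have hNN : ∀ s ∈ I, inner ℝ (N s) (N s) = (1 : ℝ) := fun s hs => by
    rw [real_inner_self_eq_norm_sq, h.norm_normal s hs, one_pow]
  have hTB : ∀ s ∈ I, inner ℝ (deriv α s) (binormal α N s) = (0 : ℝ) := fun s _ =>
    inner_self_vecProd _ _
  have hNB : ∀ s ∈ I, inner ℝ (N s) (binormal α N s) = (0 : ℝ) := fun s _ =>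
    inner_right_vecProd _ _
  have hBB : ∀ s ∈ I, inner ℝ (binormal α N s) (binormal α N s) = (1 : ℝ) := fun s hs => by
    rw [binormal, inner_vecProd_self, hTT s hs, hNN s hs, h.inner_normal s hs]; norm_num
  have dT : ∀ s ∈ I, HasDerivAt (deriv α) (curvature α s • N s) s := fun s hs => by
    rw [← h.deriv_tangent s hs]; exact (diffAt hT s hs).hasDerivAt
  have dN : ∀ s ∈ I, HasDerivAt N (deriv N s) s := fun s hs =>
    (diffAt h.smooth_normal s hs).hasDerivAt
  have dB : ∀ s ∈ I, HasDerivAt (binormal α N) (deriv (binormal α N) s) s := fun s hs =>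
    (diffAt hB s hs).hasDerivAt
  -- differentiating a constant inner product
  have dconst : ∀ {F G : ℝ → E3} {F' G' : E3} {c s : ℝ}, s ∈ I → HasDerivAt F F' s →
      HasDerivAt G G' s → (∀ t ∈ I, inner ℝ (F t) (G t) = c) →
      inner ℝ (F s) G' + inner ℝ F' (G s) = (0 : ℝ) := fun hs hF hG hc =>
    (hF.inner ℝ hG).eq_of_eqOn ho hc hs (hasDerivAt_const _ _)
  have expand : ∀ s ∈ I, ∀ v : E3, v = inner ℝ (deriv α s) v • deriv α s + inner ℝ (N s) v • N s +
      inner ℝ (binormal α N s) v • binormal α N s := by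
    intro s hs v
    obtain ⟨e, h0, h1, h2⟩ := exists_orthonormalBasis_eq (hTT s hs) (hNN s hs) (hBB s hs)
      (h.inner_normal s hs) (hTB s hs) (hNB s hs)
    rw [← h0, ← h1, ← h2]
    exact e.eq_sum_three v
  refine ⟨ho, h.ordConnected, fun s hs => (diffAt h.smooth s hs).hasDerivAt, dT, ?_, ?_, hTT, hNN,
    hBB, h.inner_normal, hTB, hNB, ?_, diffAt (hN'.inner ℝ hB)⟩
  · intro s hs
    convert dN s hs using 1
    have e1 := dconst hs (dT s hs) (dN s hs) h.inner_normal
    have e2 := dconst hs (dN s hs) (dN s hs) hNN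
    rw [real_inner_smul_left, hNN s hs] at e1
    rw [real_inner_comm (N s)] at e2
    rw [expand s hs (deriv N s), show inner ℝ (deriv α s) (deriv N s) = -curvature α s by linarith,
      show inner ℝ (N s) (deriv N s) = (0 : ℝ) by linarith, zero_smul, add_zero, torsion,
      real_inner_comm]
  · intro s hs
    convert dB s hs using 1
    have e1 := dconst hs (dT s hs) (dB s hs) hTB
    have e2 := dconst hs (dN s hs) (dB s hs) hNB
    have e3 := dconst hs (dB s hs) (dB s hs) hBB
    rw [real_inner_smul_left, hNB s hs, mul_zero, add_zero] at e1
    rw [← torsion] at e2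
    rw [real_inner_comm (binormal α N s)] at e3
    rw [expand s hs (deriv (binormal α N) s), e1,
      show inner ℝ (N s) (deriv (binormal α N) s) = -torsion α N s by linarith,
      show inner ℝ (binormal α N s) (deriv (binormal α N) s) = (0 : ℝ) by linarith]
    simp
  · -- the norm `‖α''‖` agrees with the smooth function `⟨α'', N⟩`
    intro s hs
    refine (diffAt (hT'.inner ℝ h.smooth_normal) s hs).congr_of_eventuallyEq
      (Filter.eventually_of_mem (ho.mem_nhds hs) fun t ht => ?_)
    simp only [h.deriv_tangent t ht]
    rw [real_inner_smul_left, hNN t ht, mul_one]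

/-- A curve with constant binormal is planar. -/
theorem FrenetEquations.coplanar {I : Set ℝ} {α T N B : ℝ → E3} {κ τ : ℝ → ℝ}
    (h : FrenetEquations I α T N B κ τ) (hτ : ∀ s ∈ I, τ s = 0) : Coplanar ℝ (α '' I) := by
  rcases I.eq_empty_or_nonempty with rfl | ⟨s₀, hs₀⟩
  · rw [Set.image_empty]; exact coplanar_empty ℝ E3
  have hB : ∀ s ∈ I, B s = B s₀ := fun s hs =>
    eq_of_hasDerivAt_zero h.isOpen h.ordConnected
      (fun t ht => by simpa [hτ t ht] using h.hasDerivAt_binormal t ht) hs hs₀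
  have hα : ∀ s ∈ I, inner ℝ (B s₀) (α s) = (inner ℝ (B s₀) (α s₀) : ℝ) := fun s hs =>
    eq_of_hasDerivAt_zero (F := fun t => (inner ℝ (B s₀) (α t) : ℝ)) h.isOpen h.ordConnected
      (fun t ht => by
        have := (hasDerivAt_const t (B s₀)).inner ℝ (h.hasDerivAt_curve t ht)
        rwa [← hB t ht, real_inner_comm, h.tangent_binormal t ht, inner_zero_left, add_zero,
          hB t ht] at this) hs hs₀
  have hne : B s₀ ≠ 0 := fun h0 => by simpa [h0] using h.binormal_binormal s₀ hs₀
  have hle : vectorSpan ℝ (α '' I) ≤ (ℝ ∙ B s₀)ᗮ := by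
    rw [vectorSpan_def, Submodule.span_le]
    rintro _ ⟨_, ⟨s, hs, rfl⟩, _, ⟨t, ht, rfl⟩, rfl⟩
    rw [SetLike.mem_coe, Submodule.mem_orthogonal_singleton_iff_inner_right]
    change inner ℝ (B s₀) (α s - α t) = (0 : ℝ)
    rw [inner_sub_right, hα s hs, hα t ht, sub_self]
  rw [coplanar_iff_finrank_le_two]
  have : Fact (Module.finrank ℝ E3 = 2 + 1) := ⟨by simp⟩
  exact (Submodule.finrank_mono hle).trans (Submodule.finrank_orthogonal_span_singleton hne).le

/-! ### The frame along the rulings -/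

namespace OTSurface

/-- The unit vector `w = -sin θ T + cos θ N`, which together with the ruling direction `q` and the
binormal `B` makes a positively oriented orthonormal frame `q, w, B` along the curve. -/
noncomputable def coruling (α N : ℝ → E3) (θ : ℝ → ℝ) (s : ℝ) : E3 :=
  -Real.sin (θ s) • deriv α s + Real.cos (θ s) • N s

end OTSurface

section Ruling

open OTSurface

variable {I : Set ℝ} {α N : ℝ → E3} {θ : ℝ → ℝ} {s : ℝ}

theorem IsFrenetCurve.hasDerivAt_ruling (hα : IsFrenetCurve I α N) (hs : s ∈ I)
    (hθ : DifferentiableAt ℝ θ s) :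
    HasDerivAt (ruling α N θ)
      (eta α θ s • coruling α N θ s + mu α N θ s • binormal α N s) s := by
  have h := hα.frenetEquations
  refine ((hθ.hasDerivAt.cos.smul (h.hasDerivAt_tangent s hs)).add
    (hθ.hasDerivAt.sin.smul (h.hasDerivAt_normal s hs))).congr_deriv ?_
  simp only [eta, mu, coruling]
  module

theorem IsFrenetCurve.hasDerivAt_coruling (hα : IsFrenetCurve I α N) (hs : s ∈ I)
    (hθ : DifferentiableAt ℝ θ s) :
    HasDerivAt (coruling α N θ)
      (-eta α θ s • ruling α N θ s + xi α N θ s • binormal α N s) s := by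
  have h := hα.frenetEquations
  refine ((hθ.hasDerivAt.sin.fun_neg.smul (h.hasDerivAt_tangent s hs)).add
    (hθ.hasDerivAt.cos.smul (h.hasDerivAt_normal s hs))).congr_deriv ?_
  simp only [eta, xi, ruling]
  module

theorem IsFrenetCurve.hasDerivAt_binormal (hα : IsFrenetCurve I α N) (hs : s ∈ I) :
    HasDerivAt (binormal α N)
      (-mu α N θ s • ruling α N θ s - xi α N θ s • coruling α N θ s) s := by
  refine (hα.frenetEquations.hasDerivAt_binormal s hs).congr_deriv ?_
  have e := Real.sin_sq_add_cos_sq (θ s)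
  rw [← mul_one (torsion α N s), ← e]
  simp only [mu, xi, ruling, coruling]
  module

theorem IsFrenetCurve.inner_ruling_self (hα : IsFrenetCurve I α N) (hs : s ∈ I) :
    inner ℝ (ruling α N θ s) (ruling α N θ s) = (1 : ℝ) := by
  have h := hα.frenetEquations
  simp only [ruling, inner_add_left, inner_add_right, real_inner_smul_left, real_inner_smul_right,
    real_inner_comm (deriv α s) (N s), h.tangent_tangent s hs, h.normal_normal s hs,
    h.tangent_normal s hs]
  linear_combination Real.sin_sq_add_cos_sq (θ s)

theorem IsFrenetCurve.inner_coruling_self (hα : IsFrenetCurve I α N) (hs : s ∈ I) :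
    inner ℝ (coruling α N θ s) (coruling α N θ s) = (1 : ℝ) := by
  have h := hα.frenetEquations
  simp only [coruling, inner_add_left, inner_add_right, real_inner_smul_left, real_inner_smul_right,
    real_inner_comm (deriv α s) (N s), h.tangent_tangent s hs, h.normal_normal s hs,
    h.tangent_normal s hs]
  linear_combination Real.sin_sq_add_cos_sq (θ s)

theorem IsFrenetCurve.inner_ruling_coruling (hα : IsFrenetCurve I α N) (hs : s ∈ I) :
    inner ℝ (ruling α N θ s) (coruling α N θ s) = (0 : ℝ) := by
  have h := hα.frenetEquations
  simp only [ruling, coruling, inner_add_left, inner_add_right, real_inner_smul_left,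
    real_inner_smul_right, real_inner_comm (deriv α s) (N s), h.tangent_tangent s hs,
    h.normal_normal s hs, h.tangent_normal s hs]
  ring

theorem IsFrenetCurve.inner_ruling_binormal (hα : IsFrenetCurve I α N) (hs : s ∈ I) :
    inner ℝ (ruling α N θ s) (binormal α N s) = (0 : ℝ) := by
  have h := hα.frenetEquations
  simp [ruling, inner_add_left, real_inner_smul_left, h.tangent_binormal s hs,
    h.normal_binormal s hs]

theorem IsFrenetCurve.inner_coruling_binormal (hα : IsFrenetCurve I α N) (hs : s ∈ I) :
    inner ℝ (coruling α N θ s) (binormal α N s) = (0 : ℝ) := by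
  have h := hα.frenetEquations
  simp [coruling, inner_add_left, real_inner_smul_left, h.tangent_binormal s hs,
    h.normal_binormal s hs]

theorem deriv_eq_ruling_sub_coruling (α N : ℝ → E3) (θ : ℝ → ℝ) (s : ℝ) :
    deriv α s = Real.cos (θ s) • ruling α N θ s - Real.sin (θ s) • coruling α N θ s := by
  have e := Real.sin_sq_add_cos_sq (θ s)
  conv_lhs => rw [← one_smul ℝ (deriv α s), ← e]
  simp only [ruling, coruling]
  module

end Ruling

section Equivalence

open OTSurface

/-! ### Surfaces contained in a helicoid -/

/-- A line contained in the helicoid `x sin (z / c) = y cos (z / c)` is its axis, unless it is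
horizontal; a horizontal line is a ruling. -/
theorem line_subset_helicoid {c x₀ y₀ z₀ x₁ y₁ z₁ : ℝ} (hc : c ≠ 0)
    (h : ∀ u : ℝ, (x₀ + u * x₁) * Real.sin ((z₀ + u * z₁) / c) =
      (y₀ + u * y₁) * Real.cos ((z₀ + u * z₁) / c)) :
    (z₁ ≠ 0 → x₀ = 0 ∧ y₀ = 0 ∧ x₁ = 0 ∧ y₁ = 0) ∧
      (z₁ = 0 → x₀ * Real.sin (z₀ / c) = y₀ * Real.cos (z₀ / c) ∧
        x₁ * Real.sin (z₀ / c) = y₁ * Real.cos (z₀ / c)) := by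
  constructor
  · intro hz
    have key : ∀ a : ℝ, (x₀ + (c * a - z₀) / z₁ * x₁) * Real.sin a =
        (y₀ + (c * a - z₀) / z₁ * y₁) * Real.cos a := by
      intro a
      have := h ((c * a - z₀) / z₁)
      rwa [show (z₀ + (c * a - z₀) / z₁ * z₁) / c = a by field_simp; ring] at this
    have hπ := Real.pi_ne_zero
    -- two zeros of `sin` make the affine function on the right vanish, two zeros of `cos` the left
    have h0 := key 0
    have h1 := key Real.pi
    have h2 := key (Real.pi / 2)
    have h3 := key (-(Real.pi / 2))
    simp only [Real.sin_zero, Real.cos_zero, Real.sin_pi, Real.cos_pi, Real.sin_pi_div_two,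
      Real.cos_pi_div_two, Real.sin_neg, Real.cos_neg, mul_zero, mul_one, zero_sub, mul_neg,
      neg_eq_zero] at h0 h1 h2 h3
    have hy : y₁ = 0 := by
      have : c * Real.pi * y₁ = 0 := by field_simp at h0 h1; linarith
      simpa [hc, hπ] using this
    have hx : x₁ = 0 := by
      have : c * Real.pi * x₁ = 0 := by field_simp at h2 h3; linarith
      simpa [hc, hπ] using this
    subst hy hx
    refine ⟨?_, ?_, rfl, rfl⟩ <;> linarith
  · rintro rfl
    have h0 := h 0
    have h1 := h 1
    simp only [mul_zero, add_zero, zero_mul, one_mul] at h0 h1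
    exact ⟨h0, by linarith⟩

/-- The criterion behind the minimality of helicoids, in the frame `q, w, B`. Here `P` is a
vector field orthogonal to `q` with `q' = δ P` and `P' = -δ q`, and `k` is the direction of the
axis, so that `φ_s = cos θ q + δ ((m + u) P + c k)`. -/
theorem equation_of_frame {I : Set ℝ} {α N : ℝ → E3} {θ : ℝ → ℝ} (hα : IsFrenetCurve I α N)
    (hθ : ∀ s ∈ I, DifferentiableAt ℝ θ s) {P : ℝ → E3} {k : E3} {δ m : ℝ → ℝ} {c : ℝ}
    (hδ : ∀ s ∈ I, DifferentiableAt ℝ δ s) (hm : ∀ s ∈ I, HasDerivAt m (Real.cos (θ s)) s)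
    (hP : ∀ s ∈ I, HasDerivAt P (-δ s • ruling α N θ s) s)
    (hq : ∀ s ∈ I, eta α θ s • coruling α N θ s + mu α N θ s • binormal α N s = δ s • P s)
    (hT : ∀ s ∈ I, deriv α s =
      Real.cos (θ s) • ruling α N θ s + (m s * δ s) • P s + (c * δ s) • k)
    (hPq : ∀ s ∈ I, inner ℝ (P s) (ruling α N θ s) = (0 : ℝ))
    (hkq : ∀ s ∈ I, inner ℝ k (ruling α N θ s) = (0 : ℝ)) :
    ∀ s ∈ I, ∀ u : ℝ, (f α θ s u ^ 2 + g α N θ s u ^ 2) * xi α N θ s +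
      mu α N θ s * Real.sin (θ s) * Real.cos (θ s) + quotTerm α N θ s u = 0 := by
  intro s hs u
  have ho := hα.isOpen
  let Y : ℝ → E3 := fun t => (m t + u) • P t + c • k
  have hφ : ∀ t ∈ I, δ t • Y t = -Real.sin (θ t) • coruling α N θ t +
      u • (eta α θ t • coruling α N θ t + mu α N θ t • binormal α N t) := by
    intro t ht
    have h1 := hT t ht
    rw [deriv_eq_ruling_sub_coruling α N θ t, sub_eq_add_neg, add_assoc, add_right_inj] at h1
    rw [hq t ht, neg_smul, h1]
    simp only [Y]
    module
  have hf : ∀ t ∈ I, f α θ t u = -(δ t * inner ℝ (Y t) (coruling α N θ t)) := by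
    intro t ht
    rw [← real_inner_smul_left, hφ t ht]
    simp only [inner_add_left, real_inner_smul_left, hα.inner_coruling_self ht,
      real_inner_comm (coruling α N θ t) (binormal α N t), hα.inner_coruling_binormal ht, f]
    ring
  have hg : ∀ t ∈ I, g α N θ t u = δ t * inner ℝ (Y t) (binormal α N t) := by
    intro t ht
    rw [← real_inner_smul_left, hφ t ht]
    simp only [inner_add_left, real_inner_smul_left, hα.frenetEquations.binormal_binormal t ht,
      hα.inner_coruling_binormal ht, g]
    ring
  have dY : HasDerivAt Y ((m s + u) • (-δ s • ruling α N θ s) + Real.cos (θ s) • P s) s :=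
    (((hm s hs).add_const u).smul (hP s hs)).add_const _
  have dδ := (hδ s hs).hasDerivAt
  have df := (dδ.mul (dY.inner ℝ (hα.hasDerivAt_coruling hs (hθ s hs)))).neg
  have dg := dδ.mul (dY.inner ℝ (hα.hasDerivAt_binormal (θ := θ) hs))
  have ef := (df.congr_of_eventuallyEq (Filter.eventually_of_mem (ho.mem_nhds hs) hf)).deriv
  have eg := (dg.congr_of_eventuallyEq (Filter.eventually_of_mem (ho.mem_nhds hs) hg)).deriv
  have hYq : inner ℝ (Y s) (ruling α N θ s) = (0 : ℝ) := by
    simp [Y, inner_add_left, real_inner_smul_left, hPq s hs, hkq s hs]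
  have hPw : δ s * inner ℝ (P s) (coruling α N θ s) = eta α θ s := by
    rw [← real_inner_smul_left, ← hq s hs]
    simp [inner_add_left, real_inner_smul_left, hα.inner_coruling_self hs,
      real_inner_comm (coruling α N θ s) (binormal α N s), hα.inner_coruling_binormal hs,
      -inner_self_eq_norm_sq_to_K]
  have hPB : δ s * inner ℝ (P s) (binormal α N s) = mu α N θ s := by
    rw [← real_inner_smul_left, ← hq s hs]
    simp [inner_add_left, real_inner_smul_left, hα.frenetEquations.binormal_binormal s hs,
      hα.inner_coruling_binormal hs, -inner_self_eq_norm_sq_to_K]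
  simp only [inner_add_left, inner_add_right, inner_sub_right, real_inner_smul_left,
    real_inner_smul_right, hYq, hα.inner_ruling_coruling hs, hα.inner_ruling_binormal hs] at ef eg
  have ef' : deriv (fun t => f α θ t u) s = -(deriv δ s * inner ℝ (Y s) (coruling α N θ s)) -
      Real.cos (θ s) * eta α θ s - xi α N θ s * g α N θ s u := by
    rw [ef, hg s hs, ← hPw]; ring
  have eg' : deriv (fun t => g α N θ t u) s = deriv δ s * inner ℝ (Y s) (binormal α N s) +
      Real.cos (θ s) * mu α N θ s + xi α N θ s * f α θ s u := by
    rw [eg, hf s hs, ← hPB]; ring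
  have e0 : u * mu α N θ s * eta α θ s + (Real.sin (θ s) - u * eta α θ s) * mu α N θ s =
      mu α N θ s * Real.sin (θ s) := by ring
  change g α N θ s u * eta α θ s + f α θ s u * mu α N θ s = _ at e0
  rw [quotTerm, ef', eg']
  linear_combination (-Real.cos (θ s)) * e0 -
    deriv δ s * inner ℝ (Y s) (coruling α N θ s) * hg s hs -
    deriv δ s * inner ℝ (Y s) (binormal α N s) * hf s hs

/-- If `α + ℝ q` consists of horizontal lines meeting the axis `o + ℝ e₂` and turning along the
axis at the rate of the helicoid with parameter `c`, then the surface satisfies the minimal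
surface equation, also at its singular points. -/
theorem equation_of_horizontal {I : Set ℝ} {α N : ℝ → E3} {θ : ℝ → ℝ} (hα : IsFrenetCurve I α N)
    (hθ : ∀ s ∈ I, DifferentiableAt ℝ θ s) {c : ℝ} (hc : c ≠ 0)
    (e : OrthonormalBasis (Fin 3) ℝ E3) (o : E3)
    (hq : ∀ s ∈ I, inner ℝ (e 2) (ruling α N θ s) = (0 : ℝ) ∧
      inner ℝ (e 0) (α s - o) * Real.sin (inner ℝ (e 2) (α s - o) / c) =
        inner ℝ (e 1) (α s - o) * Real.cos (inner ℝ (e 2) (α s - o) / c) ∧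
      inner ℝ (e 0) (ruling α N θ s) * Real.sin (inner ℝ (e 2) (α s - o) / c) =
        inner ℝ (e 1) (ruling α N θ s) * Real.cos (inner ℝ (e 2) (α s - o) / c)) :
    ∀ s ∈ I, ∀ u : ℝ, (f α θ s u ^ 2 + g α N θ s u ^ 2) * xi α N θ s +
      mu α N θ s * Real.sin (θ s) * Real.cos (θ s) + quotTerm α N θ s u = 0 := by
  have ho := hα.isOpen
  have hF := hα.frenetEquations
  have h00 : inner ℝ (e 0) (e 0) = (1 : ℝ) := by simp [e.inner_eq_ite, -inner_self_eq_norm_sq_to_K]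
  have h11 : inner ℝ (e 1) (e 1) = (1 : ℝ) := by simp [e.inner_eq_ite, -inner_self_eq_norm_sq_to_K]
  have h22 : inner ℝ (e 2) (e 2) = (1 : ℝ) := by simp [e.inner_eq_ite, -inner_self_eq_norm_sq_to_K]
  have h01 : inner ℝ (e 0) (e 1) = (0 : ℝ) := by simp [e.inner_eq_ite]
  have h10 : inner ℝ (e 1) (e 0) = (0 : ℝ) := by simp [e.inner_eq_ite]
  have h20 : inner ℝ (e 2) (e 0) = (0 : ℝ) := by simp [e.inner_eq_ite]
  have h21 : inner ℝ (e 2) (e 1) = (0 : ℝ) := by simp [e.inner_eq_ite]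
  -- the angle, its rate, the turning horizontal directions, and the sign of the ruling
  let t : ℝ → ℝ := fun s => inner ℝ (e 2) (α s - o) / c
  let δ : ℝ → ℝ := fun s => inner ℝ (e 2) (deriv α s) / c
  let E : ℝ → E3 := fun s => Real.cos (t s) • e 0 + Real.sin (t s) • e 1
  let p : ℝ → E3 := fun s => -Real.sin (t s) • e 0 + Real.cos (t s) • e 1
  let ρ : ℝ → ℝ := fun s => inner ℝ (E s) (ruling α N θ s)
  let m : ℝ → ℝ := fun s => inner ℝ (α s - o) (ruling α N θ s)
  have hEE : ∀ s, inner ℝ (E s) (E s) = (1 : ℝ) := fun s => by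
    simp only [E, inner_add_left, inner_add_right, real_inner_smul_left, real_inner_smul_right,
      h00, h01, h10, h11]
    linear_combination Real.sin_sq_add_cos_sq (t s)
  have hpE : ∀ s, inner ℝ (p s) (E s) = (0 : ℝ) := fun s => by
    simp only [E, p, inner_add_left, inner_add_right, real_inner_smul_left, real_inner_smul_right,
      h00, h01, h10, h11]
    ring
  have h2E : ∀ s, inner ℝ (e 2) (E s) = (0 : ℝ) := fun s => by
    simp [E, inner_add_right, real_inner_smul_right, h20, h21]
  have h2p : ∀ s, inner ℝ (e 2) (p s) = (0 : ℝ) := fun s => by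
    simp [p, inner_add_right, real_inner_smul_right, h20, h21]
  have hcz : ∀ s, inner ℝ (e 2) (α s - o) = c * t s := fun s => by
    simp only [t]; field_simp
  have hqρ : ∀ s ∈ I, ruling α N θ s = ρ s • E s := by
    intro s hs
    obtain ⟨h1, -, h3⟩ := hq s hs
    change _ * Real.sin (t s) = _ * Real.cos (t s) at h3
    have hsc := Real.sin_sq_add_cos_sq (t s)
    conv_lhs => rw [e.eq_sum_three (ruling α N θ s), h1, zero_smul, add_zero]
    simp only [ρ, E, inner_add_left, real_inner_smul_left, smul_add, smul_smul]
    congr 2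
    · linear_combination (-inner ℝ (e 0) (ruling α N θ s)) * hsc + Real.sin (t s) * h3
    · linear_combination (-inner ℝ (e 1) (ruling α N θ s)) * hsc - Real.cos (t s) * h3
  have hαE : ∀ s ∈ I, α s - o = inner ℝ (E s) (α s - o) • E s + (c * t s) • e 2 := by
    intro s hs
    obtain ⟨-, h2, -⟩ := hq s hs
    change _ * Real.sin (t s) = _ * Real.cos (t s) at h2
    have hsc := Real.sin_sq_add_cos_sq (t s)
    conv_lhs => rw [e.eq_sum_three (α s - o), hcz]
    simp only [E, inner_add_left, real_inner_smul_left, smul_add, smul_smul]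
    congr 3
    · linear_combination (-inner ℝ (e 0) (α s - o)) * hsc + Real.sin (t s) * h2
    · linear_combination (-inner ℝ (e 1) (α s - o)) * hsc - Real.cos (t s) * h2
  have hρ : ∀ s ∈ I, ρ s * ρ s = 1 := by
    intro s hs
    have := hα.inner_ruling_self (θ := θ) hs
    rwa [hqρ s hs, real_inner_smul_left, real_inner_smul_right, hEE, mul_one] at this
  have hm : ∀ s ∈ I, m s = inner ℝ (E s) (α s - o) * ρ s := by
    intro s hs
    simp only [m]
    rw [hqρ s hs, real_inner_smul_right, real_inner_comm, mul_comm]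
  have dα : ∀ s ∈ I, HasDerivAt (fun s => α s - o) (deriv α s) s := fun s hs =>
    (hF.hasDerivAt_curve s hs).sub_const o
  have dt : ∀ s ∈ I, HasDerivAt t (δ s) s := by
    intro s hs
    have := ((hasDerivAt_const s (e 2)).inner ℝ (dα s hs)).div_const c
    rwa [inner_zero_left, add_zero] at this
  have dE : ∀ s ∈ I, HasDerivAt E (δ s • p s) s := by
    intro s hs
    refine (((dt s hs).cos.smul_const (e 0)).add ((dt s hs).sin.smul_const (e 1))).congr_deriv ?_
    simp only [p]; module
  have dp : ∀ s ∈ I, HasDerivAt p (-δ s • E s) s := by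
    intro s hs
    refine (((dt s hs).sin.fun_neg.smul_const (e 0)).add
      ((dt s hs).cos.smul_const (e 1))).congr_deriv ?_
    simp only [E]; module
  -- `ρ² = 1` and `ρ` is differentiable, hence `ρ' = 0`
  have dρ : ∀ s ∈ I, HasDerivAt ρ 0 s := by
    intro s hs
    have h1 := (dE s hs).inner ℝ (hα.hasDerivAt_ruling hs (hθ s hs))
    have h2 : HasDerivAt ρ (deriv ρ s) s := h1.differentiableAt.hasDerivAt
    have h3 := (h2.mul h2).eq_of_eqOn ho hρ hs (hasDerivAt_const s (1 : ℝ))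
    have h4 : ρ s ≠ 0 := fun h0 => by simpa [h0] using hρ s hs
    have h5 : deriv ρ s = 0 := by
      have : ρ s * deriv ρ s = 0 := by linarith
      exact (mul_eq_zero.1 this).resolve_left h4
    rwa [h5] at h2
  have dq : ∀ s ∈ I, eta α θ s • coruling α N θ s + mu α N θ s • binormal α N s =
      δ s • (ρ s • p s) := by
    intro s hs
    rw [(hα.hasDerivAt_ruling hs (hθ s hs)).eq_of_eqOn ho hqρ hs ((dρ s hs).smul (dE s hs))]
    module
  have dm : ∀ s ∈ I, HasDerivAt m (Real.cos (θ s)) s := by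
    intro s hs
    refine ((dα s hs).inner ℝ (hα.hasDerivAt_ruling hs (hθ s hs))).congr_deriv ?_
    rw [dq s hs, hαE s hs, deriv_eq_ruling_sub_coruling α N θ s]
    simp only [inner_add_left, inner_sub_left, real_inner_smul_left, real_inner_smul_right, h2p,
      real_inner_comm (p s) (E s), hpE, hα.inner_ruling_self hs,
      real_inner_comm (ruling α N θ s) (coruling α N θ s), hα.inner_ruling_coruling hs]
    ring
  have hαq : ∀ s ∈ I, α s - o = m s • ruling α N θ s + (c * t s) • e 2 := by
    intro s hs
    conv_lhs => rw [hαE s hs]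
    rw [hm s hs, hqρ s hs, smul_smul, mul_assoc, hρ s hs, mul_one]
  refine equation_of_frame hα hθ (P := fun s => ρ s • p s) (k := e 2) (δ := δ) (m := m) (c := c)
    ?_ dm ?_ dq ?_ ?_ fun s hs => (hq s hs).1
  · intro s hs
    exact (((hasDerivAt_const s (e 2)).inner ℝ (hF.hasDerivAt_tangent s hs)).div_const
      c).differentiableAt
  · intro s hs
    refine ((dρ s hs).smul (dp s hs)).congr_deriv ?_
    rw [hqρ s hs]; module
  · intro s hs
    rw [(dα s hs).eq_of_eqOn ho hαq hs
      (((dm s hs).smul (hα.hasDerivAt_ruling hs (hθ s hs))).add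
        (((dt s hs).const_mul c).smul_const (e 2))), dq s hs]
    module
  · intro s hs
    simp only [hqρ s hs, real_inner_smul_left, real_inner_smul_right, hpE, mul_zero]

/-- An osculating-type ruled surface with non-planar base curve that is a helicoid satisfies the
minimal surface equation. Non-planarity excludes that every ruling is the axis. -/
theorem equation_of_isHelicoid {I : Set ℝ} {α N : ℝ → E3} {θ : ℝ → ℝ} (hα : IsFrenetCurve I α N)
    (hθ : ∀ s ∈ I, DifferentiableAt ℝ θ s) (hplane : ¬ Coplanar ℝ (α '' I))
    (hS : IsHelicoid (points I α N θ)) :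
    ∀ s ∈ I, ∀ u : ℝ, (f α θ s u ^ 2 + g α N θ s u ^ 2) * xi α N θ s +
      mu α N θ s * Real.sin (θ s) * Real.cos (θ s) + quotTerm α N θ s u = 0 := by
  obtain ⟨c, hc, J, -, -, -, e, o, hS⟩ := (isHelicoid_iff _).1 hS
  have himp : ∀ s ∈ I, ∀ u : ℝ,
      (inner ℝ (e 0) (α s - o) + u * inner ℝ (e 0) (ruling α N θ s)) *
        Real.sin ((inner ℝ (e 2) (α s - o) + u * inner ℝ (e 2) (ruling α N θ s)) / c) =
      (inner ℝ (e 1) (α s - o) + u * inner ℝ (e 1) (ruling α N θ s)) *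
        Real.cos ((inner ℝ (e 2) (α s - o) + u * inner ℝ (e 2) (ruling α N θ s)) / c) := by
    intro s hs u
    have hmem : param α N θ s u ∈ points I α N θ := ⟨s, hs, u, rfl⟩
    rw [hS] at hmem
    obtain ⟨t, -, v, hv⟩ := hmem
    have hsub : α s - o + u • ruling α N θ s =
        (v * Real.cos t) • e 0 + (v * Real.sin t) • e 1 + (c * t) • e 2 := by
      rw [param] at hv
      rw [sub_add_eq_add_sub, hv]
      abel
    simp only [← real_inner_smul_right, ← inner_add_right]
    simp only [hsub, inner_add_right, real_inner_smul_right, e.inner_eq_ite]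
    simp [hc]
    ring
  have hline := fun s hs => line_subset_helicoid hc (himp s hs)
  have hq1 : ∀ s ∈ I, inner ℝ (e 0) (ruling α N θ s) ^ 2 + inner ℝ (e 1) (ruling α N θ s) ^ 2 +
      inner ℝ (e 2) (ruling α N θ s) ^ 2 = (1 : ℝ) := by
    intro s hs
    have h1 := e.sum_inner_mul_inner (ruling α N θ s) (ruling α N θ s)
    rw [hα.inner_ruling_self hs, Fin.sum_univ_three] at h1
    simp only [real_inner_comm (ruling α N θ s)] at h1 ⊢
    linarith
  by_cases hvert : ∃ s ∈ I, inner ℝ (e 2) (ruling α N θ s) ≠ (0 : ℝ)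
  · exfalso
    obtain ⟨s₀, hs₀, hne⟩ := hvert
    have hcont : ContinuousOn (fun s => (inner ℝ (e 2) (ruling α N θ s) : ℝ) ^ 2) I := by
      intro s hs
      have := (hα.hasDerivAt_ruling hs (hθ s hs)).continuousAt
      exact ((continuousAt_const.inner this).pow 2).continuousWithinAt
    have h01 : ∀ s ∈ I, inner ℝ (e 2) (ruling α N θ s) ≠ (0 : ℝ) →
        (inner ℝ (e 2) (ruling α N θ s) : ℝ) ^ 2 = 1 := by
      intro s hs h0
      obtain ⟨-, -, h1, h2⟩ := (hline s hs).1 h0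
      have := hq1 s hs
      rw [h1, h2] at this
      linarith
    have hall : ∀ s ∈ I, inner ℝ (e 2) (ruling α N θ s) ≠ (0 : ℝ) := by
      intro s hs h0
      obtain ⟨r, hr, hr2⟩ := hα.ordConnected.isPreconnected.intermediate_value hs hs₀ hcont
        (show (1 / 2 : ℝ) ∈ _ by
          simp only [h0, h01 s₀ hs₀ hne]; norm_num)
      simp only at hr2
      rcases eq_or_ne (inner ℝ (e 2) (ruling α N θ r) : ℝ) 0 with h | h
      · rw [h] at hr2; norm_num at hr2
      · rw [h01 r hr h] at hr2; norm_num at hr2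
    refine hplane (Collinear.coplanar ?_)
    refine (collinear_iff_exists_forall_eq_smul_vadd _).2 ⟨o, e 2, ?_⟩
    rintro _ ⟨s, hs, rfl⟩
    obtain ⟨h1, h2, -, -⟩ := (hline s hs).1 (hall s hs)
    refine ⟨inner ℝ (e 2) (α s - o), ?_⟩
    have := e.eq_sum_three (α s - o)
    rw [h1, h2, zero_smul, zero_smul, zero_add, zero_add] at this
    rw [← this]; simp
  · push Not at hvert
    exact equation_of_horizontal hα hθ hc e o fun s hs =>
      ⟨hvert s hs, (hline s hs).2 (hvert s hs)⟩

/-! ### Minimal surfaces -/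

/-- The principal normals of a curve with constant curvature and nonzero constant torsion sweep out
a helicoid, whose axis has the direction `τ T + κ B` of the Darboux vector. -/
theorem isHelicoid_of_constant {I : Set ℝ} {α N : ℝ → E3} {θ : ℝ → ℝ} (hα : IsFrenetCurve I α N)
    (hne : I.Nonempty) {k t : ℝ} (hκ : ∀ s ∈ I, curvature α s = k)
    (hτ : ∀ s ∈ I, torsion α N s = t) (ht : t ≠ 0) (hcos : ∀ s ∈ I, Real.cos (θ s) = 0) :
    IsHelicoid (points I α N θ) := by
  obtain ⟨s₀, hs₀⟩ := hne
  have h := hα.frenetEquations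
  have hD : 0 < k ^ 2 + t ^ 2 := by positivity
  obtain ⟨ν, hν, hνD⟩ : ∃ ν : ℝ, 0 < ν ∧ k ^ 2 + t ^ 2 = ν ^ 2 :=
    ⟨√(k ^ 2 + t ^ 2), Real.sqrt_pos.2 hD, (Real.sq_sqrt hD.le).symm⟩
  have hν0 : ν ≠ 0 := hν.ne'
  -- `N' = ν M` and `M' = -ν N`, so `N` rotates in the plane spanned by the constant vectors
  -- `a` and `b`
  let M : ℝ → E3 := fun s => (-k / ν) • deriv α s + (t / ν) • binormal α N s
  let A : ℝ → E3 := fun s => (t / ν) • deriv α s + (k / ν) • binormal α N s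
  let a : ℝ → E3 := fun s => Real.cos (ν * s) • N s - Real.sin (ν * s) • M s
  let b : ℝ → E3 := fun s => Real.sin (ν * s) • N s + Real.cos (ν * s) • M s
  let o : ℝ → E3 := fun s => α s + (k / ν ^ 2) • N s - (t / ν * s) • A s
  have dT := fun s hs => h.hasDerivAt_tangent s hs
  have dN : ∀ s ∈ I, HasDerivAt N (ν • M s) s := by
    intro s hs
    refine (h.hasDerivAt_normal s hs).congr_deriv ?_
    simp only [hκ s hs, hτ s hs, M]
    match_scalars <;> field_simp
  have dM : ∀ s ∈ I, HasDerivAt M (-ν • N s) s := by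
    intro s hs
    refine (((dT s hs).const_smul (-k / ν)).add
      ((h.hasDerivAt_binormal s hs).const_smul (t / ν))).congr_deriv ?_
    simp only [hκ s hs, hτ s hs]
    match_scalars
    field_simp
    linarith
  have dA : ∀ s ∈ I, HasDerivAt A 0 s := by
    intro s hs
    refine (((dT s hs).const_smul (t / ν)).add
      ((h.hasDerivAt_binormal s hs).const_smul (k / ν))).congr_deriv ?_
    simp only [hκ s hs, hτ s hs]
    match_scalars
    field_simp
    ring
  have dν : ∀ s : ℝ, HasDerivAt (fun s => ν * s) ν s := fun s => by
    simpa using (hasDerivAt_id s).const_mul ν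
  have da : ∀ s ∈ I, HasDerivAt a 0 s := by
    intro s hs
    refine (((dν s).cos.smul (dN s hs)).sub ((dν s).sin.smul (dM s hs))).congr_deriv ?_
    module
  have db : ∀ s ∈ I, HasDerivAt b 0 s := by
    intro s hs
    refine (((dν s).sin.smul (dN s hs)).add ((dν s).cos.smul (dM s hs))).congr_deriv ?_
    module
  have d_origin : ∀ s ∈ I, HasDerivAt o 0 s := by
    intro s hs
    refine (((h.hasDerivAt_curve s hs).add ((dN s hs).const_smul (k / ν ^ 2))).sub
      (((hasDerivAt_id s).const_mul (t / ν)).smul (dA s hs))).congr_deriv ?_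
    simp only [M, A]
    match_scalars
    · field_simp
      linarith
    · field_simp
      ring
  have ea : ∀ s ∈ I, a s = a s₀ := fun s hs =>
    eq_of_hasDerivAt_zero h.isOpen h.ordConnected da hs hs₀
  have eb : ∀ s ∈ I, b s = b s₀ := fun s hs =>
    eq_of_hasDerivAt_zero h.isOpen h.ordConnected db hs hs₀
  have eA : ∀ s ∈ I, A s = A s₀ := fun s hs =>
    eq_of_hasDerivAt_zero h.isOpen h.ordConnected dA hs hs₀
  have eo : ∀ s ∈ I, o s = o s₀ := fun s hs =>
    eq_of_hasDerivAt_zero h.isOpen h.ordConnected d_origin hs hs₀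
  have hTT := h.tangent_tangent s₀ hs₀
  have hNN := h.normal_normal s₀ hs₀
  have hBB := h.binormal_binormal s₀ hs₀
  have hTN := h.tangent_normal s₀ hs₀
  have hTB := h.tangent_binormal s₀ hs₀
  have hNB := h.normal_binormal s₀ hs₀
  have hNT := (real_inner_comm (N s₀) (deriv α s₀)).symm.trans hTN
  have hBT := (real_inner_comm (binormal α N s₀) (deriv α s₀)).symm.trans hTB
  have hMM : inner ℝ (M s₀) (M s₀) = (1 : ℝ) := by
    simp only [M, inner_add_left, inner_add_right, real_inner_smul_left, real_inner_smul_right,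
      hTT, hBB, hTB, hBT]
    field_simp
    linarith
  have hAA : inner ℝ (A s₀) (A s₀) = (1 : ℝ) := by
    simp only [A, inner_add_left, inner_add_right, real_inner_smul_left, real_inner_smul_right,
      hTT, hBB, hTB, hBT]
    field_simp
    linarith
  have hMA : inner ℝ (M s₀) (A s₀) = (0 : ℝ) := by
    simp only [M, A, inner_add_left, inner_add_right, real_inner_smul_left, real_inner_smul_right,
      hTT, hBB, hTB, hBT]
    field_simp
    ring
  have hNM : inner ℝ (N s₀) (M s₀) = (0 : ℝ) := by
    simp only [M, inner_add_right, real_inner_smul_right, hNT, hNB, mul_zero, add_zero]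
  have hMN := (real_inner_comm (M s₀) (N s₀)).symm.trans hNM
  have hNA : inner ℝ (N s₀) (A s₀) = (0 : ℝ) := by
    simp only [A, inner_add_right, real_inner_smul_right, hNT, hNB, mul_zero, add_zero]
  have hsc := Real.sin_sq_add_cos_sq (ν * s₀)
  obtain ⟨e, he0, he1, he2⟩ := exists_orthonormalBasis_eq (a := a s₀) (b := b s₀) (c := A s₀)
    (by simp only [a, inner_sub_left, inner_sub_right, real_inner_smul_left, real_inner_smul_right,
          hNN, hMM, hNM, hMN]
        linear_combination hsc)
    (by simp only [b, inner_add_left, inner_add_right, real_inner_smul_left, real_inner_smul_right,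
          hNN, hMM, hNM, hMN]
        linear_combination hsc)
    hAA
    (by simp only [a, b, inner_sub_left, inner_add_right, real_inner_smul_left,
          real_inner_smul_right, hNN, hMM, hNM, hMN]
        ring)
    (by simp only [a, inner_sub_left, real_inner_smul_left, hNA, hMA]; ring)
    (by simp only [b, inner_add_left, real_inner_smul_left, hNA, hMA]; ring)
  have hN : ∀ s ∈ I, N s = Real.cos (ν * s) • e 0 + Real.sin (ν * s) • e 1 := by
    intro s hs
    rw [he0, he1, ← ea s hs, ← eb s hs]
    simp only [a, b]
    have hsc := Real.sin_sq_add_cos_sq (ν * s)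
    match_scalars
    · linear_combination -hsc
    · ring
    · ring
  have hpoint : ∀ s ∈ I, ∀ u, param α N θ s u = o s₀ +
      ((u * Real.sin (θ s) - k / ν ^ 2) * Real.cos (ν * s)) • e 0 +
      ((u * Real.sin (θ s) - k / ν ^ 2) * Real.sin (ν * s)) • e 1 +
      (t / ν ^ 2 * (ν * s)) • e 2 := by
    intro s hs u
    have h1 : α s = o s₀ - (k / ν ^ 2) • N s + (t / ν * s) • e 2 := by
      rw [he2, ← eo s hs, ← eA s hs]
      simp only [o]
      abel
    have h2 : t / ν ^ 2 * (ν * s) = t / ν * s := by field_simp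
    rw [param, ruling, hcos s hs, h1, hN s hs, h2]
    module
  refine (isHelicoid_iff _).2 ⟨t / ν ^ 2, by positivity, (fun x => x / ν) ⁻¹' I, ?_, ?_, ?_, e,
    o s₀, ?_⟩
  · exact h.isOpen.preimage (continuous_id.div_const ν)
  · exact h.ordConnected.preimage_mono fun x y hxy => div_le_div_of_nonneg_right hxy hν.le
  · exact ⟨ν * s₀, by simpa [hν0] using hs₀⟩
  ext x
  constructor
  · rintro ⟨s, hs, u, rfl⟩
    exact ⟨ν * s, by simpa [hν0] using hs, _, hpoint s hs u⟩
  · rintro ⟨r, hr, v, rfl⟩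
    refine ⟨r / ν, hr, Real.sin (θ (r / ν)) * (v + k / ν ^ 2), ?_⟩
    have hsin : Real.sin (θ (r / ν)) ^ 2 = 1 := by
      have := Real.sin_sq_add_cos_sq (θ (r / ν))
      rwa [hcos _ hr, zero_pow two_ne_zero, add_zero] at this
    have hv : Real.sin (θ (r / ν)) * (v + k / ν ^ 2) * Real.sin (θ (r / ν)) - k / ν ^ 2 = v := by
      linear_combination (v + k / ν ^ 2) * hsin
    rw [hpoint _ hr, hv, mul_div_cancel₀ r hν0]

/-- A minimal osculating-type ruled surface with non-planar base curve is a helicoid: the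
coefficients of the powers of `u` in the minimal surface equation force the rulings to be the
principal normals and the base curve to have constant curvature and torsion. -/
theorem isHelicoid_of_equation {I : Set ℝ} {α N : ℝ → E3} {θ : ℝ → ℝ} (hα : IsFrenetCurve I α N)
    (hθ : ContDiffOn ℝ ∞ θ I)
    (hline : ∀ a b : ℝ, a < b → Set.Ioo a b ⊆ I →
      ∃ s ∈ Set.Ioo a b, Real.sin (θ s) ≠ 0 ∨ curvature α s ≠ 0)
    (hplane : ¬ Coplanar ℝ (α '' I))
    (heq : ∀ s ∈ I, ∀ u : ℝ, (f α θ s u ^ 2 + g α N θ s u ^ 2) * xi α N θ s +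
      mu α N θ s * Real.sin (θ s) * Real.cos (θ s) + quotTerm α N θ s u = 0) :
    IsHelicoid (points I α N θ) := by
  have h := hα.frenetEquations
  have ho := hα.isOpen
  have dθ : ∀ s ∈ I, HasDerivAt θ (deriv θ s) s := fun s hs =>
    ((hθ.contDiffAt (ho.mem_nhds hs)).differentiableAt (by simp)).hasDerivAt
  have hθ' : ContDiffOn ℝ ∞ (deriv θ) I := hθ.deriv_of_isOpen ho (by simp)
  have dη : ∀ s ∈ I, HasDerivAt (eta α θ) (deriv (eta α θ) s) s := fun s hs =>
    (((hθ'.contDiffAt (ho.mem_nhds hs)).differentiableAt (by simp)).add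
      (h.differentiableAt_curvature s hs)).hasDerivAt
  have dτ : ∀ s ∈ I, HasDerivAt (torsion α N) (deriv (torsion α N) s) s := fun s hs =>
    (h.differentiableAt_torsion s hs).hasDerivAt
  have dμ : ∀ s ∈ I, HasDerivAt (mu α N θ) (deriv (torsion α N) s * Real.sin (θ s) +
      torsion α N s * (Real.cos (θ s) * deriv θ s)) s := fun s hs =>
    (dτ s hs).mul (dθ s hs).sin
  have hquot : ∀ s ∈ I, ∀ u : ℝ, quotTerm α N θ s u =
      u * mu α N θ s * (Real.cos (θ s) * deriv θ s - u * deriv (eta α θ) s) -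
      (Real.sin (θ s) - u * eta α θ s) * (u * (deriv (torsion α N) s * Real.sin (θ s) +
        torsion α N s * (Real.cos (θ s) * deriv θ s))) := by
    intro s hs u
    have df : HasDerivAt (fun r => f α θ r u) _ s := (dθ s hs).sin.sub ((dη s hs).const_mul u)
    have dg : HasDerivAt (fun r => g α N θ r u) _ s := (dμ s hs).const_mul u
    rw [quotTerm, df.deriv, dg.deriv, f, g]
  -- the coefficients of `1`, `u` and `u ^ 2`
  have c0 : ∀ s ∈ I, torsion α N s * Real.cos (θ s) * Real.sin (θ s) ^ 2 = 0 := by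
    intro s hs
    have h0 := heq s hs 0
    rw [hquot s hs] at h0
    simp only [f, g, xi, mu] at h0
    linear_combination h0 / 2
  have c1 : ∀ s ∈ I, -2 * eta α θ s * Real.sin (θ s) * xi α N θ s +
      mu α N θ s * (Real.cos (θ s) * deriv θ s) -
      Real.sin (θ s) * (deriv (torsion α N) s * Real.sin (θ s) +
        torsion α N s * (Real.cos (θ s) * deriv θ s)) = 0 := by
    intro s hs
    have h1 := heq s hs 1
    have h2 := heq s hs (-1)
    rw [hquot s hs] at h1 h2
    simp only [f, g] at h1 h2
    linear_combination (h1 - h2) / 2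
  have c2 : ∀ s ∈ I, (eta α θ s ^ 2 + mu α N θ s ^ 2) * xi α N θ s +
      eta α θ s * (deriv (torsion α N) s * Real.sin (θ s) +
        torsion α N s * (Real.cos (θ s) * deriv θ s)) -
      mu α N θ s * deriv (eta α θ) s = 0 := by
    intro s hs
    have h0 := heq s hs 0
    have h1 := heq s hs 1
    have h2 := heq s hs (-1)
    rw [hquot s hs] at h0 h1 h2
    simp only [f, g] at h0 h1 h2
    linear_combination (h1 + h2) / 2 - h0
  -- where `τ cos θ ≠ 0`, both `sin θ` and `κ` vanish, which is excluded
  have hξ : ∀ s ∈ I, torsion α N s * Real.cos (θ s) = 0 := by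
    intro s hs
    by_contra hne
    have hev : ∀ᶠ r in nhds s, torsion α N r * Real.cos (θ r) ≠ 0 ∧ r ∈ I :=
      (((dτ s hs).continuousAt.mul (dθ s hs).cos.continuousAt).eventually_ne hne).and
        (ho.mem_nhds hs)
    obtain ⟨a, b, hab, hsub⟩ := mem_nhds_iff_exists_Ioo_subset.1 hev
    have hsub' : Set.Ioo a b ⊆ I := fun r hr => (hsub hr).2
    obtain ⟨r, hr, hr'⟩ := hline a b (hab.1.trans hab.2) hsub'
    have hsin : ∀ x ∈ Set.Ioo a b, Real.sin (θ x) = 0 := fun x hx =>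
      eq_zero_of_pow_eq_zero ((mul_eq_zero.1 (c0 x (hsub' hx))).resolve_left (hsub hx).1)
    have hθ0 : deriv θ r = 0 := by
      have := (dθ r (hsub' hr)).sin.eq_of_eqOn isOpen_Ioo hsin hr (hasDerivAt_const r (0 : ℝ))
      exact (mul_eq_zero.1 this).resolve_left (right_ne_zero_of_mul (hsub hr).1)
    have h2 := c2 r (hsub' hr)
    simp only [eta, mu, xi, hsin r hr, hθ0] at h2
    have hκ : curvature α r ^ 2 * (torsion α N r * Real.cos (θ r)) = 0 := by linear_combination h2
    have := eq_zero_of_pow_eq_zero ((mul_eq_zero.1 hκ).resolve_right (hsub hr).1)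
    rcases hr' with hr' | hr'
    · exact hr' (hsin r hr)
    · exact hr' this
  -- hence `τ ^ 2` is constant
  have hττ' : ∀ s ∈ I, torsion α N s * deriv (torsion α N) s = 0 := by
    intro s hs
    have h1 := c1 s hs
    have h2 := hξ s hs
    simp only [xi, mu] at h1
    linear_combination -torsion α N s * h1 + (-2 * eta α θ s * Real.sin (θ s) * torsion α N s +
      deriv (torsion α N) s * Real.cos (θ s)) * h2 -
      torsion α N s * deriv (torsion α N) s * Real.sin_sq_add_cos_sq (θ s)
  have hτ2 : ∀ s ∈ I, ∀ r ∈ I, torsion α N s * torsion α N s = torsion α N r * torsion α N r :=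
    fun s hs r hr => eq_of_hasDerivAt_zero (F := fun x => torsion α N x * torsion α N x) ho
      hα.ordConnected
      (fun x hx => ((dτ x hx).mul (dτ x hx)).congr_deriv (by linear_combination 2 * hττ' x hx)) hs hr
  obtain ⟨s₀, hs₀, hτ0⟩ : ∃ s ∈ I, torsion α N s ≠ 0 := by
    by_contra! hcon
    exact hplane (h.coplanar hcon)
  have hτne : ∀ s ∈ I, torsion α N s ≠ 0 := fun s hs h0 => by
    have := hτ2 s₀ hs₀ s hs
    rw [h0, mul_zero] at this
    exact hτ0 (mul_self_eq_zero.1 this)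
  have hτ' : ∀ s ∈ I, deriv (torsion α N) s = 0 := fun s hs =>
    (mul_eq_zero.1 (hττ' s hs)).resolve_left (hτne s hs)
  have hcos : ∀ s ∈ I, Real.cos (θ s) = 0 := fun s hs =>
    (mul_eq_zero.1 (hξ s hs)).resolve_left (hτne s hs)
  have hsin : ∀ s ∈ I, Real.sin (θ s) ≠ 0 := fun s hs h0 => by
    have := Real.sin_sq_add_cos_sq (θ s)
    rw [h0, hcos s hs] at this
    norm_num at this
  have hθ0 : ∀ s ∈ I, deriv θ s = 0 := by
    intro s hs
    have := (dθ s hs).cos.eq_of_eqOn ho hcos hs (hasDerivAt_const s (0 : ℝ))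
    exact (mul_eq_zero.1 this).resolve_left (neg_ne_zero.2 (hsin s hs))
  have hη0 : ∀ s ∈ I, deriv (eta α θ) s = 0 := by
    intro s hs
    have h2 := c2 s hs
    simp only [xi, mu, hcos s hs, hτ' s hs, hθ0 s hs] at h2
    have : torsion α N s * Real.sin (θ s) * deriv (eta α θ) s = 0 := by linear_combination -h2
    exact (mul_eq_zero.1 this).resolve_left (mul_ne_zero (hτne s hs) (hsin s hs))
  refine isHelicoid_of_constant hα ⟨s₀, hs₀⟩ (k := curvature α s₀) (t := torsion α N s₀)
    (fun s hs => ?_) (fun s hs => ?_) hτ0 hcos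
  · have := eq_of_hasDerivAt_zero (F := eta α θ) ho hα.ordConnected
      (fun x hx => hη0 x hx ▸ dη x hx) hs hs₀
    simpa only [eta, hθ0 s hs, hθ0 s₀ hs₀, zero_add] using this
  · exact eq_of_hasDerivAt_zero ho hα.ordConnected (fun x hx => hτ' x hx ▸ dτ x hx) hs hs₀

end Equivalence

theorem corollary3p15 (I : Set ℝ) (α N : ℝ → E3) (θ : ℝ → ℝ)
    (hα : IsFrenetCurve I α N) (hθ : ContDiffOn ℝ ∞ θ I)
    (hline : ∀ a b : ℝ, a < b → Set.Ioo a b ⊆ I →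
      ∃ s ∈ Set.Ioo a b, Real.sin (θ s) ≠ 0 ∨ curvature α s ≠ 0)
    (hplane : ¬ Coplanar ℝ (α '' I)) :
    IsHelicoid (OTSurface.points I α N θ) ↔
      ∀ s ∈ I, ∀ u : ℝ,
        (OTSurface.f α θ s u ^ 2 + OTSurface.g α N θ s u ^ 2) * OTSurface.xi α N θ s +
          OTSurface.mu α N θ s * Real.sin (θ s) * Real.cos (θ s) +
          OTSurface.quotTerm α N θ s u = 0 := by
  have hθ' : ∀ s ∈ I, DifferentiableAt ℝ θ s := fun s hs =>
    (hθ.contDiffAt (hα.isOpen.mem_nhds hs)).differentiableAt (by simp)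
  exact ⟨equation_of_isHelicoid hα hθ' hplane, isHelicoid_of_equation hα hθ hline hplane⟩
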